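/- Let $\mathbb K$ be $\mathbb R$ or $\mathbb C$, let $X$ be a separable infinite-dimensional Banach space over $\mathbb K$, and let $T$ be a bounded linear operator on $X$. Assume that there is a dense linear subspace $F$ of $X$ with $T(F)\subseteq F$ such that (B1) $F$ carries an inner product $\langle\cdot,\cdot\rangle$ such that the norm $\|x\|_0=\sqrt{\langle x,x\rangle}$ defines a topology on $F$ that is (not necessarily strictly) stronger than the one inherited from $X$; (B2) the restriction $T|_F:F\to F$ has a continuous extension to the Hilbert space completion of $(F,\|\cdot\|_0)$, and this extension is an isometry with no non-trivial finite-dimensional invariant subspaces (that is, none other than $\{0\}$ and the whole space); (B3) every $x\in F$ has a backward $T$-orbit converging to $0$ in the norm of $X$, that is, there is a sequence $(x_n)_{n\ge 0}$ in $X$ with $x_0=x$, $Tx_{n+1}=x_n$ for all $n\ge 0$, and $\|x_n\|\to 0$. Then $T$ is weakly hypercyclic: there is $x\in X$ such that the orbit $\{T^nx:n\ge 0\}$ is dense in $X$ with respect to the weak topology. -/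

import Mathlib

open Filter Topology

/-- `T` is weakly hypercyclic: for some `x` the orbit `{T ^ n x : n = 0, 1, 2, …}` is dense in `X`
with respect to the weak topology. -/
def IsWeaklyHypercyclic (𝕜 : Type*) [RCLike 𝕜] {X : Type*} [NormedAddCommGroup X]
    [NormedSpace 𝕜 X] (T : X →L[𝕜] X) : Prop :=
  ∃ x : X, Dense (Set.range fun n : ℕ => toWeakSpace 𝕜 X ((T ^ n) x))

/-- `u` is a backward `T`-orbit of `x`. -/
def IsBackwardOrbit {𝕜 : Type*} [RCLike 𝕜] {X : Type*} [NormedAddCommGroup X]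
    [NormedSpace 𝕜 X] (T : X →L[𝕜] X) (x : X) (u : ℕ → X) : Prop :=
  u 0 = x ∧ ∀ n, T (u (n + 1)) = u n

/-- The vector space `F` without the topology it inherits from `X`. It is given instead the inner
product `c` and the norm `‖x‖₀ = √⟨x, x⟩` that `c` defines. -/
def PreHilbert {𝕜 : Type*} [RCLike 𝕜] {X : Type*} [NormedAddCommGroup X] [NormedSpace 𝕜 X]
    {F : Submodule 𝕜 X} (_c : InnerProductSpace.Core 𝕜 F) : Type _ := F

namespace PreHilbert

noncomputable instance instNormedAddCommGroup {𝕜 : Type*} [RCLike 𝕜] {X : Type*}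
    [NormedAddCommGroup X] [NormedSpace 𝕜 X] {F : Submodule 𝕜 X}
    (c : InnerProductSpace.Core 𝕜 F) : NormedAddCommGroup (PreHilbert c) :=
  @InnerProductSpace.Core.toNormedAddCommGroup 𝕜 F _ _ _ c

noncomputable instance instInnerProductSpace {𝕜 : Type*} [RCLike 𝕜] {X : Type*}
    [NormedAddCommGroup X] [NormedSpace 𝕜 X] {F : Submodule 𝕜 X}
    (c : InnerProductSpace.Core 𝕜 F) : InnerProductSpace 𝕜 (PreHilbert c) :=
  @InnerProductSpace.ofCore 𝕜 F _ _ _ c.toCore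

/-- The identity map from `F` to `F` with the inner product `c`. -/
def of {𝕜 : Type*} [RCLike 𝕜] {X : Type*} [NormedAddCommGroup X] [NormedSpace 𝕜 X]
    {F : Submodule 𝕜 X} (c : InnerProductSpace.Core 𝕜 F) : F ≃ₗ[𝕜] PreHilbert c where
  toFun x := x
  invFun x := x
  map_add' _ _ := rfl
  map_smul' _ _ := rfl
  left_inv _ := rfl
  right_inv _ := rfl

theorem inner_of {𝕜 : Type*} [RCLike 𝕜] {X : Type*} [NormedAddCommGroup X] [NormedSpace 𝕜 X]
    {F : Submodule 𝕜 X} (c : InnerProductSpace.Core 𝕜 F) (x y : F) :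
    inner 𝕜 (of c x) (of c y) = c.inner x y := rfl

/-- The Hilbert space completion of `F` with respect to the inner product `c`. -/
abbrev HilbertCompletion {𝕜 : Type*} [RCLike 𝕜] {X : Type*} [NormedAddCommGroup X]
    [NormedSpace 𝕜 X] {F : Submodule 𝕜 X} (c : InnerProductSpace.Core 𝕜 F) : Type _ :=
  UniformSpace.Completion (PreHilbert c)

/-- The canonical embedding of `F` into its Hilbert space completion. -/
noncomputable def toCompletion {𝕜 : Type*} [RCLike 𝕜] {X : Type*} [NormedAddCommGroup X]
    [NormedSpace 𝕜 X] {F : Submodule 𝕜 X} (c : InnerProductSpace.Core 𝕜 F) (x : F) :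
    HilbertCompletion c :=
  (of c x : UniformSpace.Completion (PreHilbert c))

/-- The topology of the norm `‖·‖₀` on `F` is stronger (not necessarily strictly) than the
topology inherited from `X`. In Mathlib's order on topologies, stronger means `≤`. -/
def IsStrongerThanInherited {𝕜 : Type*} [RCLike 𝕜] {X : Type*} [NormedAddCommGroup X]
    [NormedSpace 𝕜 X] {F : Submodule 𝕜 X} (c : InnerProductSpace.Core 𝕜 F) : Prop :=
  (inferInstance : TopologicalSpace (PreHilbert c)) ≤
    TopologicalSpace.induced (fun x : PreHilbert c => (((of c).symm x : F) : X)) inferInstance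

/-- `U` is the continuous extension, to the Hilbert space completion, of the linear operator `S`
on `F`. -/
def IsContinuousExtension {𝕜 : Type*} [RCLike 𝕜] {X : Type*} [NormedAddCommGroup X]
    [NormedSpace 𝕜 X] {F : Submodule 𝕜 X} (c : InnerProductSpace.Core 𝕜 F) (S : F →ₗ[𝕜] F)
    (U : HilbertCompletion c →L[𝕜] HilbertCompletion c) : Prop :=
  ∀ x : F, U (toCompletion c x) = toCompletion c (S x)

end PreHilbert

/-- The only finite-dimensional `U`-invariant linear subspaces of `H` are the trivial ones,
`0` and `H` itself. -/
def HasNoNontrivialFiniteDimInvariantSubspace {𝕜 : Type*} [RCLike 𝕜] {H : Type*}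
    [NormedAddCommGroup H] [NormedSpace 𝕜 H] (U : H →L[𝕜] H) : Prop :=
  ∀ W : Submodule 𝕜 H, FiniteDimensional 𝕜 W → (∀ w ∈ W, U w ∈ W) → W = ⊥ ∨ W = ⊤

/-! The vector is `x = ∑ z j`, where `z j` is the member at time `m j = p 0 + ⋯ + p j` of a backward
orbit of `v j`, and the `v j` run through a dense sequence of `F`. Then `T ^ m k x` is `v k`, plus a
tail of norm at most `2⁻ᵏ`, plus a head `d k ∈ F` with `d (k+1) = T ^ p (k+1) (d k + v k)`. As `U`
is isometric, the head need not get small in norm; it only has to be weakly small at suitable times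
(`exists_weakly_recurrent`). Without finite-dimensional invariant subspaces `U` is weakly mixing in
the mean, so the waiting times can make each head nearly orthogonal to all earlier ones and to the
next `v k`. Its squared norm then grows at most like `a k = 1 + ∑ (‖v j‖² + 1)`, and a Bessel
inequality (`sum_norm_inner_sq_div_le`) bounds `∑ |⟨h k, g⟩|² / a k`. If each target recurs so often
that `∑ 1 / a k` over its indices diverges (`exists_slow_sequence`), the coefficients against
finitely many `g` must be small at some such index. By (B1) these `g` account for all functionals on
`X`. -/

open scoped TensorProduct InnerProductSpace

/-! ### Mean weak mixing via Hilbert–Schmidt operators -/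

/-- The Hilbert–Schmidt map sending `v ⊗ w` to the rank one operator `x ↦ ⟪w, x⟫ v`. -/
noncomputable def tensorToOperator (E : Type*) [NormedAddCommGroup E] [InnerProductSpace ℝ E] :
    E ⊗[ℝ] E →ₗ[ℝ] (E →L[ℝ] E) :=
  TensorProduct.lift (LinearMap.mk₂ ℝ (fun v w => InnerProductSpace.rankOne ℝ v w)
    (fun _ _ _ => by simp) (fun _ _ _ => by simp) (fun _ _ _ => by simp) (fun _ _ _ => by simp))

theorem ContinuousLinearMap.exists_fixed_tendsto_birkhoffAverage {K : Type*}
    [NormedAddCommGroup K] [InnerProductSpace ℝ K] [CompleteSpace K] (V : K →L[ℝ] K)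
    (hV : ‖V‖ ≤ 1) (x : K) :
    ∃ ξ, V ξ = ξ ∧ Tendsto (birkhoffAverage ℝ V _root_.id · x) atTop (𝓝 ξ) :=
  ⟨_, Subtype.prop (Submodule.orthogonalProjectionOnto (V.eqLocus (1 : K →L[ℝ] K)) x),
    V.tendsto_birkhoffAverage_orthogonalProjection hV x⟩

section

variable {E : Type*} [NormedAddCommGroup E] [InnerProductSpace ℝ E]

@[simp]
theorem tensorToOperator_tmul (v w : E) :
    tensorToOperator E (v ⊗ₜ w) = InnerProductSpace.rankOne ℝ v w := rfl

theorem inner_tensorToOperator (t : E ⊗[ℝ] E) (x z : E) :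
    ⟪tensorToOperator E t x, z⟫_ℝ = ⟪t, z ⊗ₜ x⟫_ℝ := by
  induction t with
  | zero => simp
  | tmul v w => simp [inner_smul_left, mul_comm]
  | add a b ha hb => simp [inner_add_left, ha, hb]

/-- With `A` the operator of `t`, Cauchy–Schwarz for `t` and `A x ⊗ x` gives `‖A x‖² ≤ ‖t‖ ‖A x‖
‖x‖`. -/
theorem norm_tensorToOperator_le (t : E ⊗[ℝ] E) : ‖tensorToOperator E t‖ ≤ 1 * ‖t‖ := by
  rw [one_mul]
  refine ContinuousLinearMap.opNorm_le_bound _ (norm_nonneg _) fun x => ?_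
  have h := real_inner_le_norm t ((tensorToOperator E t x) ⊗ₜ[ℝ] x)
  rw [← inner_tensorToOperator, real_inner_self_eq_norm_sq, TensorProduct.norm_tmul] at h
  rcases (norm_nonneg (tensorToOperator E t x)).eq_or_lt with h0 | h0
  · rw [← h0]; positivity
  · nlinarith

theorem isCompactOperator_tensorToOperator (t : E ⊗[ℝ] E) :
    IsCompactOperator (tensorToOperator E t) := by
  induction t with
  | zero => simpa using isCompactOperator_zero
  | tmul v w =>
    have h : IsCompactOperator (ContinuousLinearMap.toSpanSingleton ℝ v) :=
      isCompactOperator_id.continuous_comp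
        (ContinuousLinearMap.toSpanSingleton ℝ v).continuous
    exact h.comp_clm (innerSL ℝ w)
  | add a b ha hb => simpa using ha.add hb

/-- If `t` has operator `A`, then `(U ⊗ U) t` has operator `U A U*`, and `U* U = 1`. Hence a fixed
vector of `U ⊗ U` yields an operator commuting with `U`. -/
theorem tensorToOperator_map (U : E →ₗᵢ[ℝ] E) (t : E ⊗[ℝ] E) (x : E) :
    tensorToOperator E (TensorProduct.mapIsometry U U t) (U x) = U (tensorToOperator E t x) := by
  induction t with
  | zero => simp
  | tmul v w => simp
  | add a b ha hb => simp_all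

variable [CompleteSpace E]

/-- The extension of `tensorToOperator` to the Hilbert tensor product. -/
noncomputable def hilbertTensorToOperator (E : Type*) [NormedAddCommGroup E]
    [InnerProductSpace ℝ E] [CompleteSpace E] :
    UniformSpace.Completion (E ⊗[ℝ] E) →L[ℝ] (E →L[ℝ] E) :=
  ((tensorToOperator E).mkContinuous 1 norm_tensorToOperator_le).fromCompletion

@[simp]
theorem hilbertTensorToOperator_coe (t : E ⊗[ℝ] E) :
    hilbertTensorToOperator E t = tensorToOperator E t := by
  simp [hilbertTensorToOperator]

theorem inner_hilbertTensorToOperator (t : UniformSpace.Completion (E ⊗[ℝ] E)) (x z : E) :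
    ⟪hilbertTensorToOperator E t x, z⟫_ℝ =
      ⟪t, ((z ⊗ₜ x : E ⊗[ℝ] E) : UniformSpace.Completion (E ⊗[ℝ] E))⟫_ℝ := by
  induction t using UniformSpace.Completion.induction_on with
  | hp => exact isClosed_eq (by fun_prop) (by fun_prop)
  | ih t => simp [inner_tensorToOperator]

theorem isCompactOperator_hilbertTensorToOperator (t : UniformSpace.Completion (E ⊗[ℝ] E)) :
    IsCompactOperator (hilbertTensorToOperator E t) := by
  induction t using UniformSpace.Completion.induction_on with
  | hp =>
    exact isClosed_setOfPred_isCompactOperator.preimage (hilbertTensorToOperator E).continuous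
  | ih t => simpa using isCompactOperator_tensorToOperator t

theorem hilbertTensorToOperator_map (U : E →ₗᵢ[ℝ] E)
    (t : UniformSpace.Completion (E ⊗[ℝ] E)) (x : E) :
    hilbertTensorToOperator E
      ((TensorProduct.mapIsometry U U).toContinuousLinearMap.completion t) (U x) =
      U (hilbertTensorToOperator E t x) := by
  induction t using UniformSpace.Completion.induction_on with
  | hp => exact isClosed_eq (by fun_prop) (U.continuous.comp (by fun_prop))
  | ih t =>
    rw [ContinuousLinearMap.completion_apply_coe, hilbertTensorToOperator_coe,
      hilbertTensorToOperator_coe]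
    exact tensorToOperator_map U t x

/-- A compact self-adjoint operator commuting with an operator that has no nonzero
finite-dimensional invariant subspace vanishes. -/
theorem eq_zero_of_isCompactOperator_of_commute {U A : E →L[ℝ] E}
    (hU : ∀ W : Submodule ℝ E, FiniteDimensional ℝ W → (∀ w ∈ W, U w ∈ W) → W = ⊥)
    (hA : IsCompactOperator A) (hs : (A : E →ₗ[ℝ] E).IsSymmetric)
    (hc : ∀ x, A (U x) = U (A x)) : A = 0 := by
  rw [← ContinuousLinearMap.eq_zero_of_forall_hasEigenvalue_eq_zero hA hs]
  intro μ hμ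
  by_contra h0
  refine hμ (hU _ (ContinuousLinearMap.finite_dimensional_eigenspace hA μ h0) fun w hw => ?_)
  rw [Module.End.mem_eigenspace_iff] at hw ⊢
  have hw' : A w = μ • w := hw
  change A (U w) = μ • U w
  rw [hc, hw', map_smul]

/-- For an isometry without finite-dimensional invariant subspaces, the squares of the matrix
coefficients converge to zero in the mean. -/
theorem tendsto_average_inner_sq (U : E →ₗᵢ[ℝ] E)
    (hU : ∀ W : Submodule ℝ E, FiniteDimensional ℝ W → (∀ w ∈ W, U w ∈ W) → W = ⊥) (y v : E) :
    Tendsto (fun N : ℕ => (N : ℝ)⁻¹ * ∑ n ∈ Finset.range N, ⟪U^[n] y, v⟫_ℝ ^ 2) atTop (𝓝 0) := by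
  set V := (TensorProduct.mapIsometry U U).toContinuousLinearMap.completion with hV
  have hV1 : ‖V‖ ≤ 1 := by
    refine ContinuousLinearMap.opNorm_le_bound _ zero_le_one fun t => ?_
    rw [one_mul]
    induction t using UniformSpace.Completion.induction_on with
    | hp => exact isClosed_le (by fun_prop) (by fun_prop)
    | ih t =>
      rw [hV, ContinuousLinearMap.completion_apply_coe]
      simp
  have hVn : ∀ n : ℕ, V^[n] ((y ⊗ₜ y : E ⊗[ℝ] E) : UniformSpace.Completion (E ⊗[ℝ] E)) =
      ((U^[n] y ⊗ₜ U^[n] y : E ⊗[ℝ] E) : UniformSpace.Completion (E ⊗[ℝ] E)) := by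
    intro n
    induction n with
    | zero => rfl
    | succ n ih =>
      rw [Function.iterate_succ_apply', ih, hV, ContinuousLinearMap.completion_apply_coe,
        Function.iterate_succ_apply']
      simp
  -- The mean ergodic theorem for `U ⊗ U` at `y ⊗ y`: the matrix entries of the operator of `ξ` are
  -- limits of averages of products of coefficients, which makes it symmetric.
  obtain ⟨ξ, hξ, hlim⟩ := V.exists_fixed_tendsto_birkhoffAverage hV1
    ((y ⊗ₜ y : E ⊗[ℝ] E) : UniformSpace.Completion (E ⊗[ℝ] E))
  have hlim' : ∀ x z : E, Tendsto (fun N : ℕ => (N : ℝ)⁻¹ *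
      ∑ n ∈ Finset.range N, ⟪U^[n] y, z⟫_ℝ * ⟪U^[n] y, x⟫_ℝ) atTop
      (𝓝 ⟪hilbertTensorToOperator E ξ x, z⟫_ℝ) := by
    intro x z
    rw [inner_hilbertTensorToOperator]
    refine (hlim.inner tendsto_const_nhds).congr fun N => ?_
    simp [birkhoffAverage, birkhoffSum, inner_smul_left, sum_inner, hVn]
  have hs : ((hilbertTensorToOperator E ξ : E →L[ℝ] E) : E →ₗ[ℝ] E).IsSymmetric := by
    intro x z
    change ⟪hilbertTensorToOperator E ξ x, z⟫_ℝ = ⟪x, hilbertTensorToOperator E ξ z⟫_ℝ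
    rw [real_inner_comm _ x]
    refine tendsto_nhds_unique (hlim' x z) ((hlim' z x).congr fun N => ?_)
    simp_rw [mul_comm ⟪_, x⟫_ℝ]
  have h0 : hilbertTensorToOperator E ξ = 0 := by
    refine eq_zero_of_isCompactOperator_of_commute (U := U.toContinuousLinearMap) hU
      (isCompactOperator_hilbertTensorToOperator ξ) hs fun x => ?_
    have h := hilbertTensorToOperator_map U ξ x
    rw [← hV, hξ] at h
    exact h
  simpa [h0, ← sq] using hlim' v v

end

theorem exists_ge_lt_of_tendsto_average {a : ℕ → ℝ} (ha : ∀ n, 0 ≤ a n)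
    (h : Tendsto (fun N : ℕ => (N : ℝ)⁻¹ * ∑ n ∈ Finset.range N, a n) atTop (𝓝 0))
    {ε : ℝ} (hε : 0 < ε) (M : ℕ) : ∃ n ≥ M, a n < ε := by
  by_contra! hc
  have h1 : ∀ᶠ N : ℕ in atTop, (N : ℝ)⁻¹ * ∑ n ∈ Finset.range N, a n < ε / 2 :=
    h.eventually (gt_mem_nhds (by positivity))
  obtain ⟨N, hN, hN2⟩ := (h1.and (eventually_ge_atTop (2 * M + 1))).exists
  have hNpos : (0 : ℝ) < N := by exact_mod_cast (by omega : 0 < N)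
  rw [inv_mul_lt_iff₀ hNpos] at hN
  have h2 : ∑ n ∈ Finset.Ico M N, ε ≤ ∑ n ∈ Finset.range N, a n := by
    refine (Finset.sum_le_sum fun n hn => hc n (Finset.mem_Ico.mp hn).1).trans
      (Finset.sum_le_sum_of_subset_of_nonneg ?_ fun n _ _ => ha n)
    intro n hn
    simp at hn ⊢
    exact hn.2
  rw [Finset.sum_const, Nat.card_Ico, nsmul_eq_mul, Nat.cast_sub (by omega)] at h2
  have h3 : (2 * M + 1 : ℝ) ≤ N := by exact_mod_cast hN2
  nlinarith

section

variable {𝕜 E : Type*} [RCLike 𝕜] [NormedAddCommGroup E] [InnerProductSpace 𝕜 E] [CompleteSpace E]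

/-- The real case for `v` and for `I • v` controls the real and imaginary parts of the coefficient.
The hypothesis descends to real scalars because the `𝕜`-span of a finite-dimensional real invariant
subspace is again finite-dimensional and invariant. -/
theorem tendsto_average_norm_inner_sq (U : E →ₗᵢ[𝕜] E)
    (hU : ∀ W : Submodule 𝕜 E, FiniteDimensional 𝕜 W → (∀ w ∈ W, U w ∈ W) → W = ⊥) (y v : E) :
    Tendsto (fun N : ℕ => (N : ℝ)⁻¹ * ∑ n ∈ Finset.range N, ‖inner 𝕜 (U^[n] y) v‖ ^ 2)
      atTop (𝓝 0) := by
  let _ : InnerProductSpace ℝ E := InnerProductSpace.rclikeToReal 𝕜 E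
  have : IsScalarTower ℝ 𝕜 E := RestrictScalars.isScalarTower ℝ 𝕜 E
  let V : E →ₗᵢ[ℝ] E := ⟨(U.toLinearMap).restrictScalars ℝ, U.norm_map⟩
  have hV : ∀ W : Submodule ℝ E, FiniteDimensional ℝ W → (∀ w ∈ W, V w ∈ W) → W = ⊥ := by
    intro W hW hinv
    have hfg : (Submodule.span 𝕜 (W : Set E)).FG := by
      obtain ⟨s, hs⟩ := (Submodule.fg_iff_finiteDimensional W).mpr hW
      refine ⟨s, le_antisymm (Submodule.span_mono ?_) (Submodule.span_le.mpr ?_)⟩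
      · rw [← hs]; exact Submodule.subset_span
      · rw [← hs]; exact Submodule.span_subset_span ℝ 𝕜 _
    have h := hU (Submodule.span 𝕜 (W : Set E))
      ((Submodule.fg_iff_finiteDimensional _).mp hfg) (fun w hw => ?_)
    · rw [Submodule.span_eq_bot] at h
      exact (Submodule.eq_bot_iff W).mpr h
    · have : Submodule.span 𝕜 (W : Set E) ≤
          (Submodule.span 𝕜 (W : Set E)).comap U.toLinearMap :=
        Submodule.span_le.mpr fun x hx => Submodule.subset_span (hinv x hx)
      exact this hw
  have h1 := tendsto_average_inner_sq V hV y v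
  have h2 := tendsto_average_inner_sq V hV y ((RCLike.I : 𝕜) • v)
  have h3 := h1.add h2
  rw [add_zero] at h3
  refine squeeze_zero (fun N => by positivity) (fun N => ?_) h3
  rw [← mul_add, ← Finset.sum_add_distrib]
  gcongr with n hn
  change ‖inner 𝕜 (U^[n] y) v‖ ^ 2 ≤ RCLike.re (inner 𝕜 (U^[n] y) v) ^ 2 +
    RCLike.re (inner 𝕜 (U^[n] y) ((RCLike.I : 𝕜) • v)) ^ 2
  rw [inner_smul_right, RCLike.I_mul_re, neg_sq, RCLike.norm_sq_eq_def]
  simp [sq]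

/-- For an isometry without nonzero finite-dimensional invariant subspaces, finitely many matrix
coefficients can be made simultaneously small at arbitrarily large times. -/
theorem exists_ge_forall_norm_inner_iterate_lt (U : E →ₗᵢ[𝕜] E)
    (hU : ∀ W : Submodule 𝕜 E, FiniteDimensional 𝕜 W → (∀ w ∈ W, U w ∈ W) → W = ⊥)
    (y : E) (S : Finset E) {ε : ℝ} (hε : 0 < ε) (M : ℕ) :
    ∃ n ≥ M, ∀ v ∈ S, ‖inner 𝕜 v (U^[n] y)‖ < ε := by
  have h : Tendsto (fun N : ℕ => (N : ℝ)⁻¹ * ∑ n ∈ Finset.range N,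
      ∑ v ∈ S, ‖inner 𝕜 (U^[n] y) v‖ ^ 2) atTop (𝓝 0) := by
    have h := tendsto_finsetSum S fun v _ => tendsto_average_norm_inner_sq U hU y v
    rw [Finset.sum_const_zero] at h
    refine h.congr fun N => ?_
    rw [← Finset.mul_sum, Finset.sum_comm]
  obtain ⟨n, hn, hlt⟩ := exists_ge_lt_of_tendsto_average (fun n => by positivity) h
    (pow_pos hε 2) M
  refine ⟨n, hn, fun v hv => ?_⟩
  rw [norm_inner_symm]
  refine lt_of_pow_lt_pow_left₀ 2 hε.le (lt_of_le_of_lt ?_ hlt)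
  exact Finset.single_le_sum (f := fun v => ‖inner 𝕜 (U^[n] y) v‖ ^ 2)
    (fun _ _ => by positivity) hv

end

/-! ### Bessel inequality for almost orthogonal vectors -/

section

variable {𝕜 E : Type*} [RCLike 𝕜] [NormedAddCommGroup E] [InnerProductSpace 𝕜 E]

/-- A Bessel inequality for almost orthogonal sequences. -/
theorem sum_norm_inner_sq_div_le {h : ℕ → E} {a : ℕ → ℝ} (ha : ∀ k, 1 ≤ a k)
    (hn : ∀ k, ‖h k‖ ^ 2 ≤ a k)
    (ho : ∀ j k, j < k → ‖inner 𝕜 (h j) (h k)‖ ≤ (1 / 2 : ℝ) ^ j * (1 / 2) ^ k)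
    (s : Finset ℕ) (g : E) :
    ∑ k ∈ s, ‖inner 𝕜 (h k) g‖ ^ 2 / a k ≤ 3 * ‖g‖ ^ 2 := by
  have ha0 : ∀ k, 0 < a k := fun k => zero_lt_one.trans_le (ha k)
  set Q := ∑ k ∈ s, ‖inner 𝕜 (h k) g‖ ^ 2 / a k with hQ
  have hQ0 : 0 ≤ Q := Finset.sum_nonneg fun k _ => div_nonneg (by positivity) (ha0 k).le
  -- The test vector `v = ∑ b k • h k` satisfies `⟨v, g⟩ = Q` and `‖v‖² ≤ Q + 4 ‖g‖²`.
  set b : ℕ → 𝕜 := fun k => ((a k)⁻¹ : ℝ) • inner 𝕜 (h k) g with hb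
  have hbn : ∀ k, ‖b k‖ = ‖inner 𝕜 (h k) g‖ / a k := fun k => by
    rw [hb, norm_smul, Real.norm_of_nonneg (inv_nonneg.mpr (ha0 k).le)]; field_simp
  have hbg : ∀ k, ‖b k‖ ≤ ‖g‖ := fun k => by
    rw [hbn, div_le_iff₀ (ha0 k)]
    refine (norm_inner_le_norm _ _).trans ?_
    have h1 : ‖h k‖ ≤ a k := by nlinarith [hn k, ha k, norm_nonneg (h k)]
    rw [mul_comm]
    gcongr
  set v := ∑ k ∈ s, b k • h k with hv
  have hvg : inner 𝕜 v g = (Q : 𝕜) := by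
    rw [hv, sum_inner, hQ, RCLike.ofReal_sum]
    refine Finset.sum_congr rfl fun k _ => ?_
    rw [inner_smul_left, hb]
    simp only [RCLike.real_smul_eq_coe_mul, map_mul, RCLike.conj_ofReal]
    rw [mul_assoc, RCLike.conj_mul]
    push_cast
    field_simp
  have hor : ∀ j k, ‖inner 𝕜 (h j) (h k)‖ ≤
      (if j = k then a j else 0) + (1 / 2 : ℝ) ^ j * (1 / 2) ^ k := by
    intro j k
    rcases lt_trichotomy j k with hjk | rfl | hjk
    · simpa [hjk.ne] using ho j k hjk
    · rw [if_pos rfl, inner_self_eq_norm_sq_to_K, norm_pow, RCLike.norm_ofReal, abs_norm]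
      exact (hn j).trans (le_add_of_nonneg_right (by positivity))
    · rw [norm_inner_symm, if_neg hjk.ne', zero_add, mul_comm]
      exact ho k j hjk
  have hvn : ‖v‖ ^ 2 ≤ Q + (∑ k ∈ s, ‖b k‖ * (1 / 2 : ℝ) ^ k) ^ 2 := by
    have h1 : ‖v‖ ^ 2 = ‖inner 𝕜 v v‖ := by
      rw [inner_self_eq_norm_sq_to_K, norm_pow, RCLike.norm_ofReal, abs_norm]
    rw [h1]
    calc ‖inner 𝕜 v v‖ = ‖∑ j ∈ s, ∑ k ∈ s, inner 𝕜 (b j • h j) (b k • h k)‖ := by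
          rw [hv, sum_inner]; simp_rw [inner_sum]
      _ ≤ ∑ j ∈ s, ∑ k ∈ s, ‖b j‖ * ‖b k‖ *
          ((if j = k then a j else 0) + (1 / 2 : ℝ) ^ j * (1 / 2) ^ k) := by
          refine (norm_sum_le _ _).trans (Finset.sum_le_sum fun j _ => ?_)
          refine (norm_sum_le _ _).trans (Finset.sum_le_sum fun k _ => ?_)
          rw [inner_smul_left, inner_smul_right, norm_mul, norm_mul, RCLike.norm_conj, ← mul_assoc]
          gcongr
          exact hor j k
      _ = Q + (∑ k ∈ s, ‖b k‖ * (1 / 2 : ℝ) ^ k) ^ 2 := by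
          simp_rw [mul_add, Finset.sum_add_distrib, mul_ite, mul_zero]
          congr 1
          · rw [hQ]
            refine Finset.sum_congr rfl fun j hj => ?_
            rw [Finset.sum_ite_eq, if_pos hj, hbn]
            have := (ha0 j).ne'
            field_simp
          · rw [sq, Finset.sum_mul_sum]
            refine Finset.sum_congr rfl fun j _ => Finset.sum_congr rfl fun k _ => by ring
  have hgeom : ∑ k ∈ s, ‖b k‖ * (1 / 2 : ℝ) ^ k ≤ ‖g‖ * 2 := by
    calc ∑ k ∈ s, ‖b k‖ * (1 / 2 : ℝ) ^ k ≤ ∑ k ∈ s, ‖g‖ * (1 / 2 : ℝ) ^ k := by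
          gcongr with k; exact hbg k
      _ = ‖g‖ * ∑ k ∈ s, (1 / 2 : ℝ) ^ k := by rw [Finset.mul_sum]
      _ ≤ ‖g‖ * 2 := by
          gcongr
          exact hasSum_geometric_two.summable.sum_le_tsum s (fun _ _ => by positivity) |>.trans
            hasSum_geometric_two.tsum_eq.le
  have hgeom0 : 0 ≤ ∑ k ∈ s, ‖b k‖ * (1 / 2 : ℝ) ^ k := by positivity
  have hQv : Q ≤ ‖v‖ * ‖g‖ := by
    have := norm_inner_le_norm (𝕜 := 𝕜) v g
    rwa [hvg, RCLike.norm_ofReal, abs_of_nonneg hQ0] at this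
  -- Cauchy–Schwarz gives `Q² ≤ (Q + 4 ‖g‖²) ‖g‖²`, which is impossible for `Q > 3 ‖g‖²`.
  by_contra! hlt
  have h1 : Q ^ 2 ≤ (Q + 4 * ‖g‖ ^ 2) * ‖g‖ ^ 2 := by
    calc Q ^ 2 ≤ (‖v‖ * ‖g‖) ^ 2 := by gcongr
      _ = ‖v‖ ^ 2 * ‖g‖ ^ 2 := by ring
      _ ≤ _ := by gcongr; nlinarith
  nlinarith [sq_nonneg ‖g‖]

end

/-! ### Scheduling the targets -/

/-- Comparison with the harmonic series: `1 + k L ≤ (1 + L) (k + 1)`. -/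
theorem exists_gt_one_le_sum_Ico {L : ℝ} (hL : 0 ≤ L) (M : ℕ) :
    ∃ N > M, 1 ≤ ∑ k ∈ Finset.Ico M N, (1 + k * L)⁻¹ := by
  have h := Real.tendsto_sum_range_one_div_nat_succ_atTop
  obtain ⟨N, hN, hNM⟩ := ((h.eventually_ge_atTop
    ((1 + L) + ∑ i ∈ Finset.range M, (1 / ((i : ℝ) + 1)))).and (eventually_gt_atTop M)).exists
  refine ⟨N, hNM, ?_⟩
  have h1 : (1 + L) ≤ ∑ k ∈ Finset.Ico M N, (1 / ((k : ℝ) + 1)) := by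
    rw [Finset.sum_Ico_eq_sub _ hNM.le]; linarith
  calc (1 : ℝ) = (1 + L)⁻¹ * (1 + L) := by field_simp
    _ ≤ (1 + L)⁻¹ * ∑ k ∈ Finset.Ico M N, (1 / ((k : ℝ) + 1)) := by gcongr
    _ = ∑ k ∈ Finset.Ico M N, ((1 + L) * ((k : ℝ) + 1))⁻¹ := by
      rw [Finset.mul_sum]; simp [mul_comm]
    _ ≤ _ := by
      gcongr with k
      nlinarith [(Nat.cast_nonneg k : (0 : ℝ) ≤ k)]

/-- Given weights `w`, there is a sequence taking each value so often that the reciprocals of the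
accumulated weights sum up to at least `1` over arbitrarily late sets of indices with that value. -/
theorem exists_slow_sequence {w : ℕ → ℝ} (hw : ∀ i, 0 ≤ w i) :
    ∃ σ : ℕ → ℕ, ∀ i M, ∃ s : Finset ℕ, (∀ k ∈ s, M ≤ k ∧ σ k = i) ∧
      1 ≤ ∑ k ∈ s, (1 + ∑ j ∈ Finset.range k, w (σ j))⁻¹ := by
  -- `τ` takes every value infinitely often. The schedule equals `τ m` on the whole block `[N m, N
  -- (m + 1))`; since `L m` bounds every weight used so far, the weight accumulated before `k` in
  -- this block is at most `k * L m`, and the block is long enough for the reciprocals to sum to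
  -- `1`.
  set τ : ℕ → ℕ := fun m => m.unpair.1
  set L : ℕ → ℝ := fun m => ∑ i ∈ Finset.range (m + 1), w (τ i)
  have hL0 : ∀ m, 0 ≤ L m := fun m => Finset.sum_nonneg fun i _ => hw _
  have hLmem : ∀ m i, i ≤ m → w (τ i) ≤ L m := fun m i hi =>
    Finset.single_le_sum (f := fun i => w (τ i)) (fun i _ => hw _)
      (Finset.mem_range.mpr (Nat.lt_succ_of_le hi))
  choose next hgt hnext using fun m M => exists_gt_one_le_sum_Ico (hL0 m) M
  set N : ℕ → ℕ := fun m => Nat.rec 0 (fun m M => next m M) m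
  have hNs : ∀ m, N (m + 1) = next m (N m) := fun m => rfl
  have hN : StrictMono N := strictMono_nat_of_lt_succ fun m => by rw [hNs]; exact hgt _ _
  set blk : ℕ → ℕ := fun k => Nat.findGreatest (fun m => N m ≤ k) k
  have hblk_le : ∀ k, N (blk k) ≤ k := fun k =>
    Nat.findGreatest_spec (P := fun m => N m ≤ k) (Nat.zero_le k) (Nat.zero_le k)
  have hle_blk : ∀ m k, N m ≤ k → m ≤ blk k := fun m k hmk =>
    Nat.le_findGreatest ((hN.id_le m).trans hmk) hmk
  have hblk_lt : ∀ m k, k < N (m + 1) → blk k ≤ m := fun m k hk =>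
    Nat.lt_succ_iff.mp (hN.lt_iff_lt.mp ((hblk_le k).trans_lt hk))
  refine ⟨fun k => τ (blk k), fun i M => ?_⟩
  obtain ⟨m, hm, hmi⟩ : ∃ m, M ≤ m ∧ τ m = i :=
    ⟨Nat.pair i M, Nat.right_le_pair i M, by simp [τ]⟩
  refine ⟨Finset.Ico (N m) (N (m + 1)), fun k hk => ?_, ?_⟩
  · rw [Finset.mem_Ico] at hk
    refine ⟨(hm.trans (hN.id_le m)).trans hk.1, ?_⟩
    change τ (blk k) = i
    rw [le_antisymm (hblk_lt m k hk.2) (hle_blk m k hk.1), hmi]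
  · refine (hnext m (N m)).trans ?_
    rw [hNs]
    refine Finset.sum_le_sum fun k hk => ?_
    rw [← hNs, Finset.mem_Ico] at hk
    have h1 : ∑ j ∈ Finset.range k, w (τ (blk j)) ≤ k * L m := by
      refine (Finset.sum_le_card_nsmul _ _ (L m) fun j hj => hLmem m _ (hblk_lt m j ?_)).trans ?_
      · exact (Finset.mem_range.mp hj).trans hk.2
      · simp
    have h2 : 0 ≤ ∑ j ∈ Finset.range k, w (τ (blk j)) := Finset.sum_nonneg fun _ _ => hw _
    gcongr

/-! ### Choice of the waiting times -/

section

variable {𝕜 E : Type*} [RCLike 𝕜] [NormedAddCommGroup E] [InnerProductSpace 𝕜 E] [CompleteSpace E]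

/-- Each waiting time makes the new vector nearly orthogonal to all earlier `h j` and also, looking
ahead, to `y (k + 1)`. The latter bounds the cross term when `y (k + 1)` is added, so that squared
norms add up to an error of `1` per step. -/
theorem exists_almost_orthogonal_recursion (U : E →ₗᵢ[𝕜] E)
    (hU : ∀ W : Submodule 𝕜 E, FiniteDimensional 𝕜 W → (∀ w ∈ W, U w ∈ W) → W = ⊥)
    (y : ℕ → E) (P : ℕ → ℕ) :
    ∃ (p : ℕ → ℕ) (h : ℕ → E), (∀ k, P k ≤ p k) ∧ h 0 = 0 ∧
      (∀ k, h (k + 1) = U^[p (k + 1)] (h k + y k)) ∧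
      (∀ j k, j < k → ‖inner 𝕜 (h j) (h k)‖ ≤ (1 / 2 : ℝ) ^ j * (1 / 2) ^ k) ∧
      ∀ k, ‖h k‖ ^ 2 ≤ ∑ j ∈ Finset.range k, (‖y j‖ ^ 2 + 1) := by
  classical
  choose q hqP hq using fun (k : ℕ) (z : E) (S : Finset E) =>
    exists_ge_forall_norm_inner_iterate_lt U hU z S
      -- Small enough both for `(1 / 2) ^ j * (1 / 2) ^ (k + 1)` with `j ≤ k` and for the bound `1 /
      -- 2` on the look-ahead coefficient.
      (ε := (1 / 2 : ℝ) ^ (k + 1) * (1 / 2) ^ (k + 1)) (by positivity) (P (k + 1))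
  let r : ℕ → E × Finset E → ℕ := fun k s => q k (s.1 + y k) (insert (y (k + 1)) s.2)
  let st : ℕ → E × Finset E := fun k => Nat.rec (0, {0})
    (fun k s => (U^[r k s] (s.1 + y k), insert (U^[r k s] (s.1 + y k)) s.2)) k
  have hst : ∀ k, (st (k + 1)).1 = U^[r k (st k)] ((st k).1 + y k) := fun k => rfl
  have hmem : ∀ k j, j ≤ k → (st j).1 ∈ (st k).2 := by
    intro k
    induction k with
    | zero =>
      intro j hj
      obtain rfl := Nat.le_zero.mp hj
      exact Finset.mem_singleton_self _
    | succ k ih =>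
      intro j hj
      change (st j).1 ∈ insert (st (k + 1)).1 (st k).2
      rcases hj.eq_or_lt with rfl | hj
      · exact Finset.mem_insert_self _ _
      · exact Finset.mem_insert_of_mem (ih j (Nat.lt_succ_iff.mp hj))
  -- The value `p 0` does not enter the recursion; it only has to satisfy the lower bound.
  let p : ℕ → ℕ := fun k => Nat.casesOn k (P 0) fun k => r k (st k)
  refine ⟨p, fun k => (st k).1, ?_, rfl, fun k => rfl, ?_, ?_⟩
  · rintro (_ | k)
    · exact le_rfl
    · exact hqP _ _ _
  · intro j k hjk
    obtain ⟨k, rfl⟩ := Nat.exists_eq_add_of_lt hjk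
    have h1 := hq (j + k) ((st (j + k)).1 + y (j + k))
      (insert (y (j + k + 1)) (st (j + k)).2) (st j).1
      (Finset.mem_insert_of_mem (hmem _ _ (by omega)))
    refine h1.le.trans ?_
    gcongr ?_ * _
    exact pow_le_pow_of_le_one (by norm_num) (by norm_num) hjk.le
  · have hy : ∀ k, 2 * RCLike.re (inner 𝕜 (st k).1 (y k)) ≤ 1 := by
      rintro (_ | k)
      · simp [st]
      · have h1 := hq k ((st k).1 + y k) (insert (y (k + 1)) (st k).2) (y (k + 1))
          (Finset.mem_insert_self _ _)
        change ‖inner 𝕜 (y (k + 1)) (st (k + 1)).1‖ < _ at h1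
        rw [norm_inner_symm] at h1
        have h2 : (1 / 2 : ℝ) ^ (k + 1) * (1 / 2) ^ (k + 1) ≤ 1 / 2 * 1 := by
          gcongr
          · exact pow_le_of_le_one (by norm_num) (by norm_num) (by omega)
          · exact pow_le_one₀ (by norm_num) (by norm_num)
        linarith [RCLike.re_le_norm (inner 𝕜 (st (k + 1)).1 (y (k + 1)))]
    intro k
    induction k with
    | zero => simp [st]
    | succ k ih =>
      have hn : ∀ (n : ℕ) (z : E), ‖U^[n] z‖ = ‖z‖ := fun n z => by
        induction n with
        | zero => rfl
        | succ n ih => rw [Function.iterate_succ_apply', U.norm_map, ih]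
      dsimp only at ih ⊢
      rw [Finset.sum_range_succ, hst, hn, norm_add_sq (𝕜 := 𝕜)]
      linarith [hy k]

/-- A recursive choice of waiting times for which the error terms `h k` return weakly to `0`
along the indices `k` of each prescribed target vector. -/
theorem exists_weakly_recurrent (U : E →ₗᵢ[𝕜] E)
    (hU : ∀ W : Submodule 𝕜 E, FiniteDimensional 𝕜 W → (∀ w ∈ W, U w ∈ W) → W = ⊥)
    (f : ℕ → E) (P : ℕ → ℕ → ℕ) :
    ∃ (σ p : ℕ → ℕ) (h : ℕ → E), (∀ k, P k (σ k) ≤ p k) ∧ h 0 = 0 ∧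
      (∀ k, h (k + 1) = U^[p (k + 1)] (h k + f (σ k))) ∧
      ∀ (i M : ℕ) (G : Finset E) (ε : ℝ), 0 < ε →
        ∃ k ≥ M, σ k = i ∧ ∀ g ∈ G, ‖inner 𝕜 g (h k)‖ < ε := by
  obtain ⟨σ, hσ⟩ := exists_slow_sequence (w := fun i => ‖f i‖ ^ 2 + 1) (fun i => by positivity)
  obtain ⟨p, h, hP, h0, hrec, hor, hn⟩ :=
    exists_almost_orthogonal_recursion U hU (fun k => f (σ k)) (fun k => P k (σ k))
  refine ⟨σ, p, h, hP, h0, hrec, fun i M G ε hε => ?_⟩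
  set a : ℕ → ℝ := fun k => 1 + ∑ j ∈ Finset.range k, (‖f (σ j)‖ ^ 2 + 1) with ha
  have ha1 : ∀ k, 1 ≤ a k := fun k => le_add_of_nonneg_right (by positivity)
  have ha0 : ∀ k, 0 < a k := fun k => zero_lt_one.trans_le (ha1 k)
  have hsum : Summable fun k => ∑ g ∈ G, ‖inner 𝕜 (h k) g‖ ^ 2 / a k := by
    refine summable_of_sum_le (c := ∑ g ∈ G, 3 * ‖g‖ ^ 2)
      (fun k => Finset.sum_nonneg fun g _ => div_nonneg (by positivity) (ha0 k).le) fun s => ?_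
    rw [Finset.sum_comm]
    exact Finset.sum_le_sum fun g _ => sum_norm_inner_sq_div_le ha1
      (fun k => (hn k).trans (by simp [ha])) hor s g
  obtain ⟨s, hs⟩ := summable_iff_vanishing_norm.mp hsum (ε ^ 2) (by positivity)
  obtain ⟨t, ht, ht1⟩ := hσ i (max M (s.sup id + 1))
  -- If every `k ∈ t` had a coefficient of size at least `ε`, the sum over `t` would be at least
  -- `ε²`, although `t` lies beyond `s`.
  by_contra! hc
  have hdisj : Disjoint t s := by
    refine Finset.disjoint_left.mpr fun k hk hks => ?_
    have h1 := (le_max_right _ _).trans (ht k hk).1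
    have h2 : k ≤ s.sup id := Finset.le_sup (f := id) hks
    omega
  have h1 := (Real.le_norm_self _).trans_lt (hs t hdisj)
  have h2 : ε ^ 2 * ∑ k ∈ t, (a k)⁻¹ ≤ ∑ k ∈ t, ∑ g ∈ G, ‖inner 𝕜 (h k) g‖ ^ 2 / a k := by
    rw [Finset.mul_sum]
    refine Finset.sum_le_sum fun k hk => ?_
    obtain ⟨g, hg, hge⟩ := hc k ((le_max_left _ _).trans (ht k hk).1) (ht k hk).2
    rw [norm_inner_symm] at hge
    refine le_trans ?_ (Finset.single_le_sum (f := fun g => ‖inner 𝕜 (h k) g‖ ^ 2 / a k)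
      (fun g _ => div_nonneg (by positivity) (ha0 k).le) hg)
    rw [← div_eq_mul_inv]
    have := ha0 k
    gcongr
  have h3 : ε ^ 2 * 1 ≤ ε ^ 2 * ∑ k ∈ t, (a k)⁻¹ := by gcongr
  linarith

end

/-! ### Weak closure, backward orbits and the Hilbert completion -/

theorem toWeakSpace_mem_closure {𝕜 : Type*} [RCLike 𝕜] {X : Type*} [NormedAddCommGroup X]
    [NormedSpace 𝕜 X] {x : X} {s : Set (WeakSpace 𝕜 X)}
    (h : ∀ (Φ : Finset (StrongDual 𝕜 X)) (ε : ℝ), 0 < ε →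
      ∃ y : X, toWeakSpace 𝕜 X y ∈ s ∧ ∀ φ ∈ Φ, ‖φ (y - x)‖ < ε) :
    toWeakSpace 𝕜 X x ∈ closure s := by
  have hb := (LinearMap.weakBilin_withSeminorms (topDualPairing 𝕜 X).flip).hasBasis_ball
    (x := (toWeakSpace 𝕜 X x : WeakSpace 𝕜 X))
  refine (mem_closure_iff_nhds_basis hb).mpr fun r hr => ?_
  obtain ⟨y, hy, hφ⟩ := h r.1 r.2 hr
  refine ⟨_, hy, ?_⟩
  exact (Seminorm.mem_ball _).mpr (Seminorm.finset_sup_apply_lt hr fun φ hφΦ => hφ φ hφΦ)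

section

variable {𝕜 : Type*} [RCLike 𝕜] {X : Type*} [NormedAddCommGroup X] [NormedSpace 𝕜 X]

theorem IsBackwardOrbit.pow_apply_add {T : X →L[𝕜] X} {x : X} {u : ℕ → X}
    (hu : IsBackwardOrbit T x u) (n k : ℕ) : (T ^ n) (u (n + k)) = u k := by
  induction n with
  | zero => simp
  | succ n ih =>
    rw [pow_succ, ContinuousLinearMap.mul_def, ContinuousLinearMap.comp_apply,
      show n + 1 + k = n + k + 1 by ring, hu.2, ih]

/-- Adding up suitable members of backward orbits of `v k` gives a vector whose orbit returns to
`v k`, up to the contribution `d k` of the previous vectors and a small error. -/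
theorem exists_orbit_near [CompleteSpace X] (T : X →L[𝕜] X) {v d : ℕ → X} {u : ℕ → ℕ → X}
    {p : ℕ → ℕ} (hu : ∀ k, IsBackwardOrbit T (v k) (u k))
    (hp : ∀ k n, p k ≤ n → ‖u k n‖ ≤ (1 / 2 : ℝ) ^ k)
    (hd0 : d 0 = 0) (hd : ∀ k, d (k + 1) = (T ^ p (k + 1)) (d k + v k)) :
    ∃ (x : X) (m : ℕ → ℕ), ∀ k, ‖(T ^ m k) x - (d k + v k)‖ ≤ (1 / 2 : ℝ) ^ k := by
  set m : ℕ → ℕ := fun k => ∑ j ∈ Finset.range (k + 1), p j with hm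
  have hms : ∀ k, m (k + 1) = p (k + 1) + m k := fun k => by
    rw [hm]; simp only; rw [Finset.sum_range_succ, add_comm]
  have hpm : ∀ k, p k ≤ m k := fun k =>
    Finset.single_le_sum (fun _ _ => Nat.zero_le _) (Finset.self_mem_range_succ k)
  have hmono : Monotone m := monotone_nat_of_le_succ fun k => by rw [hms]; omega
  set z : ℕ → X := fun j => u j (m j) with hz
  have hzs : Summable z := Summable.of_norm_bounded summable_geometric_two
    fun j => hp j _ (hpm j)
  have hTz : ∀ k, (T ^ m k) (z k) = v k := fun k => by
    rw [hz]
    simpa [(hu k).1] using (hu k).pow_apply_add (m k) 0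
  have hhead : ∀ k, (T ^ m k) (∑ j ∈ Finset.range k, z j) = d k := by
    intro k
    induction k with
    | zero => simp [hd0]
    | succ k ih =>
      rw [hms, pow_add, ContinuousLinearMap.mul_def, ContinuousLinearMap.comp_apply,
        Finset.sum_range_succ, map_add, ih, hTz, hd]
  -- Since `m (j + k + 1) - m k ≥ p (j + k + 1)`, applying `T ^ m k` leaves a member of the backward
  -- orbit late enough for `hp`.
  have htail : ∀ k j, ‖(T ^ m k) (z (j + (k + 1)))‖ ≤ (1 / 2 : ℝ) ^ (k + 1) * (1 / 2) ^ j := by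
    intro k j
    have h1 : p (j + (k + 1)) + m k ≤ m (j + (k + 1)) := by
      rw [show j + (k + 1) = j + k + 1 by ring, hms]
      exact Nat.add_le_add_left (hmono (by omega)) _
    obtain ⟨l, hl⟩ := Nat.exists_eq_add_of_le ((Nat.le_add_left _ _).trans h1)
    rw [hz]
    simp only
    rw [hl, (hu _).pow_apply_add, ← pow_add, add_comm (k + 1)]
    exact hp _ _ (by omega)
  refine ⟨∑' j, z j, m, fun k => ?_⟩
  rw [← hzs.sum_add_tsum_nat_add (k + 1), map_add, Finset.sum_range_succ, map_add, hhead, hTz,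
    add_sub_cancel_left, (T ^ m k).map_tsum ((summable_nat_add_iff (k + 1)).mpr hzs)]
  have hg := (hasSum_geometric_two).mul_left ((1 / 2 : ℝ) ^ (k + 1))
  refine (tsum_of_norm_bounded hg (htail k)).trans_eq ?_
  rw [pow_succ]
  ring

variable {F : Submodule 𝕜 X} (c : InnerProductSpace.Core 𝕜 F)

/-- A continuous functional on `X` is represented on `F` by a vector of the Hilbert completion. -/
theorem PreHilbert.exists_inner_toCompletion_eq (hB1 : PreHilbert.IsStrongerThanInherited c)
    (φ : StrongDual 𝕜 X) : ∃ g : PreHilbert.HilbertCompletion c, ∀ z : F,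
      inner 𝕜 g (PreHilbert.toCompletion c z) = φ z := by
  let ι : PreHilbert c →L[𝕜] X :=
    ⟨F.subtype ∘ₗ (PreHilbert.of c).symm.toLinearMap, continuous_iff_le_induced.mpr hB1⟩
  refine ⟨(InnerProductSpace.toDual 𝕜 _).symm (φ.comp ι).fromCompletion, fun z => ?_⟩
  rw [InnerProductSpace.toDual_symm_apply]
  exact ContinuousLinearMap.fromCompletion_apply_coe (φ.comp ι) (PreHilbert.of c z)

/-- `F` embeds in its completion, and a finite-dimensional `F` would be closed in `X`, hence all of
`X`. This excludes the whole space as a finite-dimensional invariant subspace in (B2). -/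
theorem PreHilbert.not_finiteDimensional_hilbertCompletion (hX : ¬ FiniteDimensional 𝕜 X)
    (hF : Dense (F : Set X)) : ¬ FiniteDimensional 𝕜 (PreHilbert.HilbertCompletion c) := by
  intro h
  have hinj : Function.Injective
      ((UniformSpace.Completion.toComplₗᵢ (𝕜 := 𝕜) (E := PreHilbert c)).toLinearMap ∘ₗ
        (PreHilbert.of c).toLinearMap) :=
    (UniformSpace.Completion.toComplₗᵢ (𝕜 := 𝕜) (E := PreHilbert c)).injective.comp
      (PreHilbert.of c).injective
  have hfd : FiniteDimensional 𝕜 F := FiniteDimensional.of_injective _ hinj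
  have htop : F = ⊤ := by
    rw [← F.closed_of_finiteDimensional.submodule_topologicalClosure_eq]
    exact Submodule.dense_iff_topologicalClosure_eq_top.mp hF
  subst htop
  exact hX (Module.Finite.equiv (Submodule.topEquiv (R := 𝕜) (M := X)))

end

/-! ### Assembling the weakly hypercyclic vector -/

theorem theorem1p1 {𝕜 : Type*} [RCLike 𝕜] {X : Type*} [NormedAddCommGroup X] [NormedSpace 𝕜 X]
    [CompleteSpace X] [TopologicalSpace.SeparableSpace X] (hX : ¬ FiniteDimensional 𝕜 X)
    (T : X →L[𝕜] X)
    (F : Submodule 𝕜 X) (hFT : ∀ x ∈ F, T x ∈ F) (hFdense : Dense (F : Set X))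
    (c : InnerProductSpace.Core 𝕜 F)
    (hB1 : PreHilbert.IsStrongerThanInherited c)
    (hB2 : ∃ U : PreHilbert.HilbertCompletion c →L[𝕜] PreHilbert.HilbertCompletion c,
      PreHilbert.IsContinuousExtension c ((T : X →ₗ[𝕜] X).restrict hFT) U ∧
      Isometry U ∧ HasNoNontrivialFiniteDimInvariantSubspace U)
    (hB3 : ∀ x ∈ F, ∃ u : ℕ → X, IsBackwardOrbit T x u ∧ Tendsto u atTop (𝓝 0)) :
    IsWeaklyHypercyclic 𝕜 T := by
  classical
  obtain ⟨U, hUext, hUiso, hUinv⟩ := hB2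
  let V : PreHilbert.HilbertCompletion c →ₗᵢ[𝕜] PreHilbert.HilbertCompletion c :=
    ⟨U.toLinearMap, (AddMonoidHomClass.isometry_iff_norm U).mp hUiso⟩
  have hV : ∀ W : Submodule 𝕜 (PreHilbert.HilbertCompletion c), FiniteDimensional 𝕜 W →
      (∀ w ∈ W, V w ∈ W) → W = ⊥ := by
    intro W hW hinv
    refine (hUinv W hW hinv).resolve_right fun htop => ?_
    subst htop
    exact PreHilbert.not_finiteDimensional_hilbertCompletion c hX hFdense
      (Module.Finite.equiv (Submodule.topEquiv (R := 𝕜)))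
  let f : ℕ → F := TopologicalSpace.denseSeq F
  choose u hu hulim using fun i => hB3 (f i) (f i).2
  have hP : ∀ k i, ∃ N, ∀ n ≥ N, ‖u i n‖ ≤ (1 / 2 : ℝ) ^ k := by
    intro k i
    have h := (hulim i).norm
    rw [norm_zero] at h
    exact eventually_atTop.mp (h.eventually (ge_mem_nhds (by positivity)))
  choose P hP using hP
  obtain ⟨σ, p, h, hp, h0, hrec, hweak⟩ :=
    exists_weakly_recurrent V hV (fun i => PreHilbert.toCompletion c (f i)) P
  let S : F →ₗ[𝕜] F := (T : X →ₗ[𝕜] X).restrict hFT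
  -- The same recursion as for `h`, run inside `F`: its image in the completion is `h k`, and its
  -- image in `X` is the head of the series.
  let d : ℕ → F := fun k => Nat.rec 0 (fun k z => S^[p (k + 1)] (z + f (σ k))) k
  have hds : ∀ k, d (k + 1) = S^[p (k + 1)] (d k + f (σ k)) := fun k => rfl
  have hSU : ∀ (n : ℕ) (z : F), PreHilbert.toCompletion c (S^[n] z) =
      V^[n] (PreHilbert.toCompletion c z) := by
    intro n z
    induction n with
    | zero => rfl
    | succ n ih =>
      rw [Function.iterate_succ_apply', Function.iterate_succ_apply', ← ih]
      exact (hUext _).symm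
  have hST : ∀ (n : ℕ) (z : F), ((S^[n] z : F) : X) = (T ^ n) z := by
    intro n z
    induction n with
    | zero => rfl
    | succ n ih =>
      rw [Function.iterate_succ_apply', pow_succ',
        ContinuousLinearMap.mul_def, ContinuousLinearMap.comp_apply, ← ih]
      rfl
  have hdh : ∀ k, PreHilbert.toCompletion c (d k) = h k := by
    intro k
    induction k with
    | zero => rw [h0]; exact UniformSpace.Completion.coe_zero
    | succ k ih =>
      rw [hds, hSU, hrec, ← ih]
      congr 1
      exact UniformSpace.Completion.coe_add _ _
  have hdT : ∀ k, (d (k + 1)).1 = (T ^ p (k + 1)) ((d k).1 + (f (σ k)).1) := fun k => by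
    rw [hds, hST, Submodule.coe_add]
  obtain ⟨x, m, hx⟩ := exists_orbit_near T (v := fun k => (f (σ k)).1) (d := fun k => (d k).1)
    (u := fun k => u (σ k)) (p := p) (fun k => hu (σ k))
    (fun k n hn => hP k (σ k) n ((hp k).trans hn)) rfl hdT
  choose g hg using PreHilbert.exists_inner_toCompletion_eq c hB1
  refine ⟨x, ?_⟩
  set R := Set.range fun n : ℕ => toWeakSpace 𝕜 X ((T ^ n) x)
  have hmem : ∀ i, toWeakSpace 𝕜 X (f i : X) ∈ closure R := by
    refine fun i => toWeakSpace_mem_closure fun Φ ε hε => ?_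
    have hsmall : ∀ᶠ k : ℕ in atTop, ∀ φ ∈ Φ, ‖φ‖ * (1 / 2 : ℝ) ^ k < ε / 2 := by
      refine (eventually_all_finset Φ).mpr fun φ _ => ?_
      have h1 := (tendsto_pow_atTop_nhds_zero_of_lt_one (by norm_num : (0 : ℝ) ≤ 1 / 2)
        (by norm_num)).const_mul ‖φ‖
      rw [mul_zero] at h1
      exact h1.eventually (gt_mem_nhds (by positivity))
    obtain ⟨M, hM⟩ := eventually_atTop.mp hsmall
    obtain ⟨k, hkM, hki, hk⟩ := hweak i M (Φ.image g) (ε / 2) (by positivity)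
    refine ⟨(T ^ m k) x, ⟨m k, rfl⟩, fun φ hφ => ?_⟩
    have h1 : ‖φ (d k).1‖ < ε / 2 := by
      rw [← hg, hdh]
      exact hk _ (Finset.mem_image_of_mem g hφ)
    have h2 : ‖φ ((T ^ m k) x - ((d k).1 + f (σ k)))‖ < ε / 2 :=
      ((φ.le_opNorm _).trans (by gcongr; exact hx k)).trans_lt (hM k hkM φ hφ)
    have h3 : (T ^ m k) x - f i = ((T ^ m k) x - ((d k).1 + f (σ k))) + (d k).1 := by
      rw [hki]; abel
    rw [h3, map_add]
    exact (norm_add_le _ _).trans_lt (by linarith)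
  -- Weakly closed sets are norm closed, so norm density of the `f i` in `F` and of `F` in `X`
  -- suffices.
  have hclosed : IsClosed (toWeakSpaceCLM 𝕜 X ⁻¹' closure R) :=
    isClosed_closure.preimage (toWeakSpaceCLM 𝕜 X).continuous
  have hF : (F : Set X) ⊆ toWeakSpaceCLM 𝕜 X ⁻¹' closure R := by
    intro z hz
    have h1 : (⟨z, hz⟩ : F) ∈ closure (Set.range f) := TopologicalSpace.denseRange_denseSeq F _
    have h2 : closure (Set.range f) ⊆ Subtype.val ⁻¹' (toWeakSpaceCLM 𝕜 X ⁻¹' closure R) :=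
      closure_minimal (Set.range_subset_iff.mpr hmem) (hclosed.preimage continuous_subtype_val)
    exact h2 h1
  intro y
  exact closure_minimal hF hclosed (hFdense ((toWeakSpace 𝕜 X).symm y))
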